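/- **Conventions.** A *lattice* is a finitely generated free $\mathbb Z$-module $L$ with a positive definite symmetric bilinear form $B: L\times L\to\mathbb Z$; put $Q(x)=B(x,x)$. Its scale $\mathfrak s(L)$ is the ideal of $\mathbb Z$ generated by all $B(x,y)$ with $x,y\in L$, and its norm $\mathfrak n(L)$ is the ideal generated by all $Q(x)$ with $x\in L$; $L$ is *normalized* if $\mathfrak n(L)=2\mathbb Z$. For a prime $p$ let $L_p=\mathbb Z_p\otimes_{\mathbb Z}L$, with $B$ and $Q$ extended to $L_p$, and $Q(L_p)=\{Q(x):x\in L_p\}$. A lattice $K$ is in the *genus* of $L$ if $K$ and $L$ become isometric over $\mathbb Z_p$ for every prime $p$ and over $\mathbb R$. A lattice $N$ is *primitively represented* by $L$ if there is a linear map $\sigma:N\to L$ preserving the bilinear forms whose image $\sigma(N)$ is a direct summand of $L$; it is primitively represented by the genus of $L$ if it is primitively represented by some lattice in that genus. $L$ is *strictly $n$-regular* if it primitively represents every lattice of rank $n$ that is primitively represented by its genus. For a positive integer $m$ the *Watson transform* is the lattice $$\Lambda_m(L)=\{x\in L: Q(x+z)\equiv Q(z) \bmod m\ \text{ for all } z\in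 L\}$$ with the restricted bilinear form. **Proposition.** Let $p$ be a prime, let $n\ge 0$ be an integer, and let $L$ be a normalized strictly $n$-regular lattice. Assume that either $p=2$ and $\mathfrak s(L)=2\mathbb Z$, or $Q(L_p)\neq 2\mathbb Z_p$. Then $\Lambda_{2p}(L)$ is also strictly $n$-regular. -/

import Mathlib

open scoped TensorProduct

universe u

/-- A lattice: a finitely generated free `ℤ`-module with an integer valued symmetric bilinear form
that is positive definite. The ambient quadratic space over `ℚ` is `ℚ ⊗ L`. -/
structure PosDefLattice where
  carrier : Type u
  [addCommGroup : AddCommGroup carrier]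
  [free : Module.Free ℤ carrier]
  [finite : Module.Finite ℤ carrier]
  /-- the bilinear form -/
  B : LinearMap.BilinForm ℤ carrier
  symm : ∀ x y, B x y = B y x
  pos : ∀ x, x ≠ 0 → 0 < B x x

namespace PosDefLattice

instance : CoeSort PosDefLattice.{u} (Type u) := ⟨carrier⟩

attribute [instance] addCommGroup free finite

/-- The quadratic map, normalised by `Q x = B x x`. -/
def Q (L : PosDefLattice.{u}) (x : L) : ℤ := L.B x x

/-- The rank of a lattice. -/
noncomputable def rank (L : PosDefLattice.{u}) : ℕ := Module.finrank ℤ L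

/-- The scale: the ideal generated by all `B x y`. -/
def scale (L : PosDefLattice.{u}) : Ideal ℤ := Ideal.span {a | ∃ x y : L, a = L.B x y}

/-- The norm: the ideal generated by all `Q x`. -/
def norm (L : PosDefLattice.{u}) : Ideal ℤ := Ideal.span {a | ∃ x : L, a = L.Q x}

/-- A lattice is normalized if its norm ideal is `2ℤ`. -/
def IsNormalized (L : PosDefLattice.{u}) : Prop := L.norm = Ideal.span {2}

/-- The bilinear form on the extension of scalars `R ⊗ L`. For `R = ℤ_[p]` this is the
`ℤ_[p]`-lattice `L_p`. -/
noncomputable def extB (R : Type) [CommRing R] (L : PosDefLattice.{u}) :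
    LinearMap.BilinForm R (R ⊗[ℤ] L) :=
  LinearMap.BilinForm.baseChange R L.B

/-- The set `Q(L_p)` of all values of the quadratic map on `L_p = ℤ_[p] ⊗ L`. -/
def localValues (p : ℕ) [Fact p.Prime] (L : PosDefLattice.{u}) : Set ℤ_[p] :=
  {a | ∃ x : ℤ_[p] ⊗[ℤ] L, a = L.extB ℤ_[p] x x}

/-- `L` and `K` become isometric over `R`. -/
def IsometricOver (R : Type) [CommRing R] (L K : PosDefLattice.{u}) : Prop :=
  ∃ e : (R ⊗[ℤ] L) ≃ₗ[R] (R ⊗[ℤ] K), ∀ x y, K.extB R (e x) (e y) = L.extB R x y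

/-- `K` belongs to the genus of `L`: the two are isometric over every `ℤ_[p]` and over `ℝ`. -/
def InGenus (K L : PosDefLattice.{u}) : Prop :=
  (∀ (p : ℕ) [Fact p.Prime], IsometricOver ℤ_[p] L K) ∧ IsometricOver ℝ L K

/-- `M` is primitively represented by `L`: some linear map `M → L` preserving the bilinear forms
(hence injective, by definiteness) has a direct summand of `L` as its image. -/
def PrimitivelyRepresents (L M : PosDefLattice.{u}) : Prop :=
  ∃ σ : M →ₗ[ℤ] L, (∀ x y, L.B (σ x) (σ y) = M.B x y) ∧
    ∃ T : Submodule ℤ L, IsCompl (LinearMap.range σ) T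

/-- `L` is strictly `n`-regular: it primitively represents every lattice of rank `n` that is
primitively represented by some lattice in its genus. -/
def IsStrictlyRegular (n : ℕ) (L : PosDefLattice.{u}) : Prop :=
  ∀ N : PosDefLattice.{u}, N.rank = n →
    (∃ K : PosDefLattice.{u}, InGenus K L ∧ PrimitivelyRepresents K N) →
      PrimitivelyRepresents L N

/-- A submodule of a lattice, with the restricted form, as a lattice. -/
def sublattice (L : PosDefLattice.{u}) (S : Submodule ℤ L) : PosDefLattice.{u} where
  carrier := S
  B := L.B.restrict S
  symm x y := L.symm x y
  pos x hx := L.pos x (fun h => hx (Subtype.ext h))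

/-- The set `{x ∈ L | Q (x + z) ≡ Q z mod m for all z ∈ L}`, as a submodule of `L`. -/
def watsonSubmodule (m : ℕ) (L : PosDefLattice.{u}) : Submodule ℤ L :=
  AddSubgroup.toIntSubmodule
    { carrier := {x | ∀ z : L, L.Q (x + z) ≡ L.Q z [ZMOD m]}
      zero_mem' := fun z => by rw [zero_add]
      add_mem' := fun {x y} hx hy z => by
        rw [add_assoc]
        exact (hx (y + z)).trans (hy z)
      neg_mem' := fun {x} hx z => by
        have h := hx (-x + z)
        rw [add_neg_cancel_left] at h
        exact h.symm }

/-- The Watson transform `Λ_m(L)`. -/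
def watson (m : ℕ) (L : PosDefLattice.{u}) : PosDefLattice.{u} :=
  L.sublattice (L.watsonSubmodule m)

end PosDefLattice

/-! ### Direct summands of finitely generated abelian groups. -/

section Saturated

variable {X : Type*} [AddCommGroup X]

/-! Under either local hypothesis the Watson transform is the set `W` of `x` with `2p ∣ Q x`
(`IsNormalized.mem_watsonSubmodule_iff`), so membership depends on `Q x` alone. By
`InGenus.exists_lift`, each `M` in the genus of `W` sits in some `K` in the genus of `L`, with `pK ⊆
M ⊆ K` and `M` cut out by the same divisibility.

If `N` is primitive in `M`, let `P` be its saturation in `K`; then `P` has rank `n` and `P ∩ M = N`.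
Strict regularity embeds `P` primitively in `L` by an isometry `σ`. As `σ` preserves `Q`, `σ(P) ∩ W
= σ(P ∩ M) = σ(N)`, so `σ(N)` is primitive in `W`.

The quotient by `S` is torsion-free and finitely generated, hence projective, so the quotient map
splits. -/

theorem Submodule.exists_isCompl_of_saturated [Module.Finite ℤ X] (S : Submodule ℤ X)
    (hS : ∀ k : ℤ, k ≠ 0 → ∀ x, k • x ∈ S → x ∈ S) : ∃ T, IsCompl S T := by
  have : Module.IsTorsionFree ℤ (X ⧸ S) := by
    refine .of_smul_eq_zero fun k x h => ?_
    induction x using Submodule.Quotient.induction_on with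
    | H x =>
      by_cases hk : k = 0
      · exact Or.inl hk
      · rw [← Submodule.Quotient.mk_smul, Submodule.Quotient.mk_eq_zero] at h
        exact Or.inr ((Submodule.Quotient.mk_eq_zero S).2 (hS k hk x h))
  obtain ⟨g, hg⟩ := Module.projective_lifting_property S.mkQ LinearMap.id S.mkQ_surjective
  have hg' : ∀ y, S.mkQ (g y) = y := fun y => LinearMap.congr_fun hg y
  refine ⟨LinearMap.range g, ?_, ?_⟩
  · rw [Submodule.disjoint_def]
    rintro _ hx ⟨y, rfl⟩
    rw [← hg' y, (Submodule.Quotient.mk_eq_zero S (x := g y)).2 hx |> (S.mkQ_apply (g y)).trans,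
      map_zero]
  · rw [codisjoint_iff, eq_top_iff]
    intro x _
    rw [← sub_add_cancel x (g (S.mkQ x))]
    refine Submodule.add_mem_sup ?_ ⟨_, rfl⟩
    rw [← Submodule.Quotient.mk_eq_zero, ← Submodule.mkQ_apply, map_sub, hg', sub_self]

theorem IsCompl.mem_of_smul_mem [Module.IsTorsionFree ℤ X] {S T : Submodule ℤ X} (h : IsCompl S T)
    {k : ℤ} (hk : k ≠ 0) {x : X} (hx : k • x ∈ S) : x ∈ S := by
  obtain ⟨a, ha, b, hb, rfl⟩ := Submodule.mem_sup.1 (h.sup_eq_top.ge (Submodule.mem_top (x := x)))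
  have hkb : k • b ∈ S := by
    have := S.sub_mem hx (S.smul_mem k ha)
    rwa [smul_add, add_sub_cancel_left] at this
  have h0 := Submodule.disjoint_def.1 h.disjoint _ hkb (T.smul_mem k hb)
  rw [smul_eq_zero_iff_right hk] at h0
  rwa [h0, add_zero]

end Saturated

/-! ### Extension of scalars of injections with cokernel killed by an integer. -/

section BaseChange

theorem LinearEquiv.exists_of_range_eq {R X Y Z : Type*} [CommRing R] [AddCommGroup X]
    [AddCommGroup Y] [AddCommGroup Z] [Module R X] [Module R Y] [Module R Z]
    {f : X →ₗ[R] Z} {g : Y →ₗ[R] Z} (hf : Function.Injective f) (hg : Function.Injective g)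
    (h : LinearMap.range f = LinearMap.range g) : ∃ φ : X ≃ₗ[R] Y, ∀ x, g (φ x) = f x := by
  refine ⟨(LinearEquiv.ofInjective f hf).trans
    ((LinearEquiv.ofEq _ _ h).trans (LinearEquiv.ofInjective g hg).symm), fun x => ?_⟩
  have := LinearEquiv.apply_symm_apply (LinearEquiv.ofInjective g hg)
    (LinearEquiv.ofEq _ _ h (LinearEquiv.ofInjective f hf x))
  exact congrArg Subtype.val this

variable {R X Y : Type*} [CommRing R] [AddCommGroup X] [AddCommGroup Y]

theorem LinearMap.baseChange_injective_of_flat [Module.Flat ℤ R] {f : X →ₗ[ℤ] Y}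
    (hf : Function.Injective f) : Function.Injective (f.baseChange R) := by
  have := Module.Flat.lTensor_preserves_injective_linearMap (M := R) f hf
  rwa [← LinearMap.baseChange_eq_ltensor] at this

theorem LinearMap.smul_mem_range_baseChange (f : X →ₗ[ℤ] Y) {d : ℤ}
    (hf : ∀ y, d • y ∈ LinearMap.range f) (y : R ⊗[ℤ] Y) :
    (d : R) • y ∈ LinearMap.range (f.baseChange R) := by
  induction y using TensorProduct.induction_on with
  | zero => rw [smul_zero]; exact Submodule.zero_mem _
  | add a b ha hb => rw [smul_add]; exact Submodule.add_mem _ ha hb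
  | tmul r y =>
    obtain ⟨x, hx⟩ := hf y
    refine ⟨r ⊗ₜ x, ?_⟩
    rw [LinearMap.baseChange_tmul, hx, Int.cast_smul_eq_zsmul, TensorProduct.tmul_smul]

theorem LinearMap.baseChange_bijective_of_isUnit [Module.Flat ℤ R] {f : X →ₗ[ℤ] Y}
    (hf : Function.Injective f) {d : ℤ} (hd : IsUnit (d : R))
    (hfd : ∀ y, d • y ∈ LinearMap.range f) : Function.Bijective (f.baseChange R) := by
  refine ⟨LinearMap.baseChange_injective_of_flat hf, fun y => ?_⟩
  obtain ⟨u, hu⟩ := hd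
  have := (LinearMap.range (f.baseChange R)).smul_mem (↑u⁻¹ : R)
    (LinearMap.smul_mem_range_baseChange f hfd y)
  rwa [← hu, smul_smul, Units.inv_mul, one_smul] at this

end BaseChange

/-! ### Reduction modulo `p` and a Hensel argument over `ℤ_[p]`. -/

section Padic

variable {p : ℕ} [Fact p.Prime] {X : Type*} [AddCommGroup X]

theorem PadicInt.exists_int_add_mul (r : ℤ_[p]) : ∃ (k : ℤ) (s : ℤ_[p]), r = k + p * s := by
  have h := PadicInt.appr_spec 1 r
  rw [Ideal.mem_span_singleton, pow_one] at h
  obtain ⟨s, hs⟩ := h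
  exact ⟨r.appr 1, s, by rw [← hs]; push_cast; ring⟩

theorem PadicInt.exists_one_tmul_add_smul (x : ℤ_[p] ⊗[ℤ] X) :
    ∃ (a : X) (b : ℤ_[p] ⊗[ℤ] X), x = 1 ⊗ₜ a + (p : ℤ_[p]) • b := by
  induction x using TensorProduct.induction_on with
  | zero => exact ⟨0, 0, by simp⟩
  | add x y hx hy =>
    obtain ⟨a, b, rfl⟩ := hx
    obtain ⟨a', b', rfl⟩ := hy
    exact ⟨a + a', b + b', by rw [TensorProduct.tmul_add, smul_add]; abel⟩
  | tmul r x =>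
    obtain ⟨k, s, rfl⟩ := PadicInt.exists_int_add_mul r
    refine ⟨k • x, s ⊗ₜ x, ?_⟩
    rw [TensorProduct.add_tmul, ← TensorProduct.smul_tmul, TensorProduct.smul_tmul', zsmul_one,
      smul_eq_mul]

theorem PadicInt.exists_eq_smul_of_one_tmul_eq_smul [Module.Free ℤ X]
    [Module.Finite ℤ X] {x : X}
    {y : ℤ_[p] ⊗[ℤ] X} (h : (1 : ℤ_[p]) ⊗ₜ[ℤ] x = (p : ℤ_[p]) • y) : ∃ z : X, x = (p : ℤ) • z := by
  let b := Module.Free.chooseBasis ℤ X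
  have hdvd : ∀ i, (p : ℤ) ∣ b.repr x i := by
    intro i
    have h1 := congrArg (fun t => (b.baseChange ℤ_[p]).repr t i) h
    simp only [Module.Basis.baseChange_repr_tmul, map_smul, Finsupp.smul_apply, smul_eq_mul,
      zsmul_one] at h1
    have := (PadicInt.pow_p_dvd_int_iff (p := p) 1 (b.repr x i)).1 ⟨_, by rw [h1, pow_one]⟩
    rwa [pow_one] at this
  choose c hc using hdvd
  refine ⟨∑ i, c i • b i, ?_⟩
  rw [Finset.smul_sum]
  conv_lhs => rw [← b.sum_repr x]
  exact Finset.sum_congr rfl fun i _ => by rw [smul_smul, ← hc]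

/-- A quadratic polynomial over `ℤ_[p]` that is linear with unit slope modulo `p` has a root. -/
theorem PadicInt.exists_quadratic_eq {a b c : ℤ_[p]} (hb : IsUnit b) :
    ∃ s : ℤ_[p], p * a * s ^ 2 + b * s + c = 0 := by
  obtain ⟨u, rfl⟩ := hb
  let F : Polynomial ℤ_[p] := .C (p * a) * .X ^ 2 + .C (u : ℤ_[p]) * .X + .C c
  have hp : ∀ t : ℤ_[p], ‖p * t‖ < 1 := fun t => by
    rw [PadicInt.norm_lt_one_iff_dvd]; exact dvd_mul_right _ _
  -- The root of the linear part: there the polynomial is divisible by `p` and its derivative is a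
  -- unit, so Hensel's lemma applies.
  let s₀ : ℤ_[p] := -(↑u⁻¹ * c)
  have h1 : F.aeval s₀ = p * (a * s₀ ^ 2) := by
    simp only [F, map_add, map_mul, map_pow, Polynomial.aeval_X, Polynomial.aeval_C,
      Algebra.algebraMap_self, RingHom.id_apply, s₀]
    linear_combination -c * u.mul_inv
  have h2 : F.derivative.aeval s₀ = u + p * (2 * a * s₀) := by
    simp [F]; ring
  have h3 : ‖F.derivative.aeval s₀‖ = 1 := by
    rw [h2, ← PadicInt.isUnit_iff]
    by_contra hu
    rw [PadicInt.not_isUnit_iff] at hu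
    have := PadicInt.norm_lt_one_add hu (hp (-(2 * a * s₀)))
    rw [mul_neg (p : ℤ_[p]), add_neg_cancel_right, PadicInt.norm_units] at this
    exact lt_irrefl _ this
  obtain ⟨z, hz, -⟩ := hensels_lemma (F := F) (a := s₀) (by rw [h3, h1, one_pow]; exact hp _)
  refine ⟨z, ?_⟩
  simpa [F] using hz

end Padic

/-! ### Extended forms, the Watson transform and lifting in the genus. -/

namespace PosDefLattice

theorem extB_tmul (R : Type) [CommRing R] (L : PosDefLattice.{u}) (a b : R) (x y : L) :
    L.extB R (a ⊗ₜ x) (b ⊗ₜ y) = (L.B x y : R) * (a * b) := by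
  rw [extB, LinearMap.BilinForm.baseChange_tmul, zsmul_eq_mul]

theorem extB_one_tmul (R : Type) [CommRing R] (L : PosDefLattice.{u}) (x y : L) :
    L.extB R (1 ⊗ₜ x) (1 ⊗ₜ y) = (L.B x y : R) := by
  rw [extB_tmul, mul_one, mul_one]

theorem extB_symm (R : Type) [CommRing R] (L : PosDefLattice.{u}) (x y : R ⊗[ℤ] L) :
    L.extB R x y = L.extB R y x :=
  (LinearMap.BilinForm.IsSymm.baseChange R ⟨L.symm⟩).eq x y

theorem extB_baseChange (R : Type) [CommRing R] {L K : PosDefLattice.{u}} (f : L →ₗ[ℤ] K) {c : ℤ}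
    (hf : ∀ x y, K.B (f x) (f y) = c * L.B x y) (x y : R ⊗[ℤ] L) :
    K.extB R (f.baseChange R x) (f.baseChange R y) = c * L.extB R x y := by
  induction x using TensorProduct.induction_on with
  | zero => simp
  | add a b ha hb => simp only [map_add, LinearMap.add_apply, ha, hb, mul_add]
  | tmul r a =>
    induction y using TensorProduct.induction_on with
    | zero => simp
    | add b c hb hc => simp only [map_add, hb, hc, mul_add]
    | tmul s b =>
      rw [LinearMap.baseChange_tmul, LinearMap.baseChange_tmul, extB_tmul, extB_tmul, hf]
      push_cast; ring

theorem isometry_injective {L K : PosDefLattice.{u}} {f : L →ₗ[ℤ] K}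
    (hf : ∀ x y, K.B (f x) (f y) = L.B x y) : Function.Injective f := by
  rw [injective_iff_map_eq_zero]
  intro x hx
  by_contra h
  have := L.pos x h
  rw [← hf, hx, map_zero] at this
  exact lt_irrefl _ this

theorem IsometricOver.trans {R : Type} [CommRing R] {L K M : PosDefLattice.{u}}
    (h₁ : IsometricOver R L K) (h₂ : IsometricOver R K M) : IsometricOver R L M := by
  obtain ⟨e, he⟩ := h₁
  obtain ⟨f, hf⟩ := h₂
  exact ⟨e.trans f, fun x y => by simp only [LinearEquiv.trans_apply, hf, he]⟩

theorem IsometricOver.symm {R : Type} [CommRing R] {L K : PosDefLattice.{u}}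
    (h : IsometricOver R L K) : IsometricOver R K L := by
  obtain ⟨e, he⟩ := h
  exact ⟨e.symm, fun x y => by rw [← he, e.apply_symm_apply, e.apply_symm_apply]⟩

/-- Applied with `d = p` over `ℤ_[q]`, `q ≠ p`, and over `ℝ`: passing between `L` and `W`, or
between `M` and `K`, changes nothing away from `p`. -/
theorem IsometricOver.of_isUnit {R : Type} [CommRing R] [Module.Flat ℤ R] {L K : PosDefLattice.{u}}
    {f : L →ₗ[ℤ] K} (hf : ∀ x y, K.B (f x) (f y) = L.B x y) {d : ℤ} (hd : IsUnit (d : R))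
    (hfd : ∀ y, d • y ∈ LinearMap.range f) : IsometricOver R L K :=
  ⟨LinearEquiv.ofBijective _
    (LinearMap.baseChange_bijective_of_isUnit (isometry_injective hf) hd hfd), fun x y => by
      simpa using extB_baseChange R f (c := 1) (by simpa using hf) x y⟩

theorem IsNormalized.two_dvd {L : PosDefLattice.{u}} (h : L.IsNormalized) (x : L) :
    (2 : ℤ) ∣ L.Q x := by
  rw [← Ideal.mem_span_singleton, ← h]
  exact Ideal.subset_span ⟨x, rfl⟩

theorem IsNormalized.two_dvd_extB {L : PosDefLattice.{u}} (h : L.IsNormalized) (R : Type)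
    [CommRing R] (x : R ⊗[ℤ] L) : (2 : R) ∣ L.extB R x x := by
  induction x using TensorProduct.induction_on with
  | zero => simp
  | add a b ha hb =>
    have : L.extB R (a + b) (a + b) = L.extB R a a + L.extB R b b + 2 * L.extB R a b := by
      simp only [map_add, LinearMap.add_apply, extB_symm R L b a]; ring
    rw [this]
    exact dvd_add (dvd_add ha hb) (dvd_mul_right _ _)
  | tmul r a =>
    rw [extB_tmul]
    obtain ⟨k, hk⟩ := h.two_dvd a
    rw [Q] at hk
    rw [hk]
    exact ⟨k * (r * r), by push_cast; ring⟩

theorem Q_add (L : PosDefLattice.{u}) (x z : L) : L.Q (x + z) = L.Q x + L.Q z + 2 * L.B x z := by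
  simp only [Q, map_add, LinearMap.add_apply, L.symm z x]; ring

theorem mem_watsonSubmodule {m : ℕ} {L : PosDefLattice.{u}} {x : L} :
    x ∈ L.watsonSubmodule m ↔ ∀ z : L, L.Q (x + z) ≡ L.Q z [ZMOD m] := Iff.rfl

variable {p : ℕ} [Fact p.Prime] {L : PosDefLattice.{u}}

/-- If `Q x` is divisible by `2 p` but `B x z` is a unit at `p`, then `x` and `z` span a hyperbolic
plane over `ℤ_[p]`. -/
theorem IsNormalized.localValues_eq (h : L.IsNormalized) {x z : L} (hx : (2 * p : ℤ) ∣ L.Q x)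
    (hz : ¬ (p : ℤ) ∣ L.B x z) :
    L.localValues p = (Ideal.span {(2 : ℤ_[p])} : Set ℤ_[p]) := by
  ext w
  rw [SetLike.mem_coe, Ideal.mem_span_singleton]
  constructor
  · rintro ⟨y, rfl⟩
    exact h.two_dvd_extB _ y
  · rintro ⟨w, rfl⟩
    obtain ⟨a, ha⟩ := hx
    obtain ⟨c, hc⟩ := h.two_dvd z
    have hu : IsUnit (L.B x z : ℤ_[p]) := by
      by_contra hu
      rw [PadicInt.not_isUnit_iff, PadicInt.norm_int_lt_one_iff_dvd] at hu
      exact hz hu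
    -- This is half of the equation `Q (s x + z) = 2 w`.
    obtain ⟨s, hs⟩ := PadicInt.exists_quadratic_eq (a := a) (c := (c : ℤ_[p]) - w) hu
    refine ⟨s ⊗ₜ x + 1 ⊗ₜ z, ?_⟩
    rw [Q] at ha hc
    simp only [map_add, LinearMap.add_apply, extB_tmul, L.symm z x, ha, hc]
    push_cast
    linear_combination -2 * hs

/-- Since `Q (x + z) - Q z = Q x + 2 B x z`, the point is that `2p ∣ Q x` forces `p ∣ B x z`. The
scale gives this in the first case; in the second, a failure would make `Q(L_p)` all of `2ℤ_p`. -/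
theorem IsNormalized.mem_watsonSubmodule_iff (h : L.IsNormalized)
    (hloc : (p = 2 ∧ L.scale = Ideal.span {2}) ∨
      L.localValues p ≠ (Ideal.span {(2 : ℤ_[p])} : Set ℤ_[p])) {x : L} :
    x ∈ L.watsonSubmodule (2 * p) ↔ (2 * p : ℤ) ∣ L.Q x := by
  rw [mem_watsonSubmodule]
  constructor
  · intro hx
    have := (hx 0).symm.dvd
    simpa [Q] using this
  · intro hx z
    have hB : (p : ℤ) ∣ L.B x z := by
      rcases hloc with ⟨rfl, hs⟩ | hne
      · have : L.B x z ∈ L.scale := Ideal.subset_span ⟨x, z, rfl⟩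
        rw [hs, Ideal.mem_span_singleton] at this
        exact_mod_cast this
      · by_contra hB
        exact hne (h.localValues_eq hx hB)
    refine (Int.modEq_iff_dvd.2 ?_).symm
    rw [Q_add]
    push_cast
    obtain ⟨k, hk⟩ := hx
    obtain ⟨l, hl⟩ := hB
    exact ⟨k + l, by rw [hk, hl]; ring⟩

theorem IsNormalized.two_mul_dvd_iff (h : L.IsNormalized) (x : L) :
    (2 * p : ℤ_[p]) ∣ (L.Q x : ℤ_[p]) ↔ (2 * p : ℤ) ∣ L.Q x := by
  obtain ⟨k, hk⟩ := h.two_dvd x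
  rw [hk, mul_dvd_mul_iff_left two_ne_zero, Int.cast_mul, Int.cast_ofNat,
    mul_dvd_mul_iff_left two_ne_zero]
  simpa using PadicInt.pow_p_dvd_int_iff (p := p) 1 k

/-- Let `W = {x ∈ L | 2 p ∣ Q x}`. Every lattice `M` in the genus of `W` arises in the same way from
some `K` in the genus of `L`: there `K` is `p⁻¹` times the sublattice of `M` that corresponds to
`p L_p` under an isometry `W_p ≃ M_p`. -/
theorem InGenus.exists_lift (h : L.IsNormalized) {W : Submodule ℤ L}
    (hW : ∀ x, x ∈ W ↔ (2 * p : ℤ) ∣ L.Q x) {M : PosDefLattice.{u}}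
    (hM : InGenus M (L.sublattice W)) :
    ∃ K : PosDefLattice.{u}, InGenus K L ∧ ∃ j : M →ₗ[ℤ] K, (∀ x y, K.B (j x) (j y) = M.B x y) ∧
      (∀ y : K, (p : ℤ) • y ∈ LinearMap.range j) ∧
      ∀ y : K, (2 * p : ℤ_[p]) ∣ (K.Q y : ℤ_[p]) ↔ y ∈ LinearMap.range j := by
  have hp0 : (p : ℤ) ≠ 0 := by exact_mod_cast (Fact.out : p.Prime).ne_zero
  have hp0' : (p : ℤ_[p]) ≠ 0 := by exact_mod_cast (Fact.out : p.Prime).ne_zero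
  have hpW : ∀ x : L, (p : ℤ) • x ∈ W := fun x => by
    obtain ⟨k, hk⟩ := h.two_dvd x
    rw [hW]
    refine ⟨p * k, ?_⟩
    rw [Q] at hk ⊢
    simp only [map_smul, LinearMap.smul_apply, hk, smul_eq_mul]; ring
  let i : L.sublattice W →ₗ[ℤ] L := W.subtype
  have hi : ∀ x y, L.B (i x) (i y) = (L.sublattice W).B x y := fun _ _ => rfl
  let ι : L →ₗ[ℤ] L.sublattice W := LinearMap.codRestrict W ((p : ℤ) • LinearMap.id) hpW
  have hιB : ∀ x y, (L.sublattice W).B (ι x) (ι y) = ((p : ℤ) ^ 2) * L.B x y := fun x y => by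
    change L.B ((p : ℤ) • x) ((p : ℤ) • y) = _
    simp only [map_smul, LinearMap.smul_apply, smul_eq_mul]; ring
  have hιi : ∀ x, ι (i x) = (p : ℤ) • x := fun x => Subtype.ext rfl
  have hι : Function.Injective ι := fun x y hxy => by
    have : (p : ℤ) • x = (p : ℤ) • y := congrArg Subtype.val hxy
    exact smul_right_injective _ hp0 this
  obtain ⟨e, he⟩ := hM.1 p
  -- The image of `f` is the copy of `p L_p` inside `M_p`; `S` below is its intersection with `M`.
  let f : ℤ_[p] ⊗[ℤ] L →ₗ[ℤ_[p]] ℤ_[p] ⊗[ℤ] M := e.toLinearMap ∘ₗ ι.baseChange ℤ_[p]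
  have hfB : ∀ x y, M.extB ℤ_[p] (f x) (f y) = (p : ℤ_[p]) ^ 2 * L.extB ℤ_[p] x y := fun x y => by
    have := extB_baseChange ℤ_[p] ι hιB x y
    push_cast at this
    rw [← this, ← he]; rfl
  have hf : Function.Injective f :=
    e.injective.comp (LinearMap.baseChange_injective_of_flat hι)
  have hfi : ∀ m, f (i.baseChange ℤ_[p] m) = (p : ℤ_[p]) • e m := fun m => by
    have : ι.baseChange ℤ_[p] (i.baseChange ℤ_[p] m) = (p : ℤ_[p]) • m := by
      rw [← LinearMap.comp_apply, ← LinearMap.baseChange_comp]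
      rw [show ι ∘ₗ i = (p : ℤ) • LinearMap.id from LinearMap.ext hιi, LinearMap.baseChange_smul,
        LinearMap.baseChange_id]
      simp [← Int.cast_smul_eq_zsmul ℤ_[p]]
    change e (ι.baseChange ℤ_[p] (i.baseChange ℤ_[p] m)) = _
    rw [this, map_smul]
  have hpf : ∀ m, (p : ℤ_[p]) • m ∈ LinearMap.range f := fun m =>
    ⟨i.baseChange ℤ_[p] (e.symm m), by rw [hfi, e.apply_symm_apply]⟩
  let S : Submodule ℤ M :=
    ((LinearMap.range f).restrictScalars ℤ).comap (TensorProduct.mk ℤ ℤ_[p] M 1)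
  have hS : ∀ x, x ∈ S ↔ (1 : ℤ_[p]) ⊗ₜ x ∈ LinearMap.range f := fun _ => Iff.rfl
  have hpS : ∀ x : M, (p : ℤ) • x ∈ S := fun x => by
    rw [hS, TensorProduct.tmul_smul, ← Int.cast_smul_eq_zsmul ℤ_[p]]
    simpa using hpf (1 ⊗ₜ x)
  have hdvd : ∀ x y : S, (p : ℤ) ^ 2 ∣ M.B x y := fun x y => by
    obtain ⟨a, ha⟩ := (hS x).1 x.2
    obtain ⟨b, hb⟩ := (hS y).1 y.2
    rw [← PadicInt.pow_p_dvd_int_iff, ← extB_one_tmul, ← ha, ← hb, hfB]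
    exact dvd_mul_right _ _
  -- Dividing the form on `S` by `p²` models `p⁻¹ S`. Then `κ` is multiplication by `p` into `M`,
  -- and `j` is the inclusion of `M` in `p⁻¹ S`.
  let K : PosDefLattice.{u} :=
    { carrier := S
      B := LinearMap.mk₂ ℤ (fun x y : S => M.B x y / (p : ℤ) ^ 2)
        (fun x y z => by
          simp only [Submodule.coe_add, map_add, LinearMap.add_apply]
          exact Int.add_ediv_of_dvd_left (hdvd x z))
        (fun c x y => by
          simp only [Submodule.coe_smul, map_smul, LinearMap.smul_apply, smul_eq_mul]
          exact Int.mul_ediv_assoc _ (hdvd x y))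
        (fun x y z => by
          simp only [Submodule.coe_add, map_add]
          exact Int.add_ediv_of_dvd_left (hdvd x y))
        (fun c x y => by
          simp only [Submodule.coe_smul, map_smul, smul_eq_mul]
          exact Int.mul_ediv_assoc _ (hdvd x y))
      symm := fun x y => by simp only [LinearMap.mk₂_apply, M.symm x y]
      pos := fun x hx => by
        rw [LinearMap.mk₂_apply]
        exact Int.ediv_pos_of_pos_of_dvd (M.pos _ fun h0 => hx (Subtype.ext h0)) (by positivity)
          (hdvd x x) }
  let κ : K →ₗ[ℤ] M := S.subtype
  have hκ : Function.Injective κ := S.injective_subtype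
  have hκB : ∀ x y, M.B (κ x) (κ y) = (p : ℤ) ^ 2 * K.B x y := fun x y =>
    (Int.mul_ediv_cancel' (hdvd x y)).symm
  let j : M →ₗ[ℤ] K := LinearMap.codRestrict S ((p : ℤ) • LinearMap.id) hpS
  have hκj : ∀ x, κ (j x) = (p : ℤ) • x := fun _ => rfl
  have hjκ : ∀ x, j (κ x) = (p : ℤ) • x := fun x => Subtype.ext rfl
  have hj : ∀ x y, K.B (j x) (j y) = M.B x y := fun x y => by
    have := hκB (j x) (j y)
    rw [hκj, hκj] at this
    simp only [map_smul, LinearMap.smul_apply, smul_eq_mul] at this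
    exact mul_left_cancel₀ (pow_ne_zero 2 hp0) (by rw [← this]; ring)
  have hpj : ∀ y, (p : ℤ) • y ∈ LinearMap.range j := fun y => ⟨κ y, hjκ y⟩
  have hpi : ∀ y, (p : ℤ) • y ∈ LinearMap.range i := fun y => ⟨⟨_, hpW y⟩, rfl⟩
  -- Both sides contain `p M_p`, and modulo `p M_p` every element comes from `M`.
  have hrange : LinearMap.range f = LinearMap.range (κ.baseChange ℤ_[p]) := by
    have hpκ : ∀ m, (p : ℤ_[p]) • m ∈ LinearMap.range (κ.baseChange ℤ_[p]) := fun m => by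
      simpa using LinearMap.smul_mem_range_baseChange (R := ℤ_[p]) κ (d := p)
        (fun y => ⟨j y, hκj y⟩) m
    apply le_antisymm
    · intro a ha
      obtain ⟨x, b, rfl⟩ := PadicInt.exists_one_tmul_add_smul a
      have hx : x ∈ S := by
        rw [hS]
        simpa using Submodule.sub_mem _ ha (hpf b)
      exact Submodule.add_mem _ ⟨1 ⊗ₜ (⟨x, hx⟩ : S), rfl⟩ (hpκ b)
    · rintro _ ⟨a, rfl⟩
      induction a using TensorProduct.induction_on with
      | zero => rw [map_zero]; exact Submodule.zero_mem _
      | add a b ha hb => rw [map_add]; exact Submodule.add_mem _ ha hb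
      | tmul r x =>
        have := Submodule.smul_mem _ r ((hS x.1).1 x.2)
        rwa [TensorProduct.smul_tmul', smul_eq_mul, mul_one] at this
  refine ⟨K, ⟨?_, ?_⟩, j, hj, hpj, ?_⟩
  · intro q _
    by_cases hq : q = p
    · subst hq
      obtain ⟨φ, hφ⟩ := LinearEquiv.exists_of_range_eq hf
        (LinearMap.baseChange_injective_of_flat hκ) hrange
      refine ⟨φ, fun x y => mul_left_cancel₀ (pow_ne_zero 2 hp0') ?_⟩
      rw [← hfB, ← hφ, ← hφ, extB_baseChange ℤ_[q] κ hκB]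
      push_cast; rfl
    · have hu : IsUnit ((p : ℤ) : ℤ_[q]) := by
        rw [Int.cast_natCast, PadicInt.isUnit_iff, PadicInt.norm_natCast_eq_one_iff]
        exact (Nat.coprime_primes Fact.out Fact.out).2 hq
      exact ((IsometricOver.of_isUnit hi hu hpi).symm.trans (hM.1 q)).trans
        (IsometricOver.of_isUnit hj hu hpj)
  · have hu : IsUnit ((p : ℤ) : ℝ) := IsUnit.mk0 _ (by exact_mod_cast hp0)
    exact ((IsometricOver.of_isUnit hi hu hpi).symm.trans hM.2).trans
      (IsometricOver.of_isUnit hj hu hpj)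
  · intro y
    constructor
    · intro hy
      obtain ⟨l, hl⟩ := (hS y.1).1 y.2
      have hQ : L.extB ℤ_[p] l l = (K.Q y : ℤ_[p]) := by
        refine mul_left_cancel₀ (pow_ne_zero 2 hp0') ?_
        rw [← hfB, hl, extB_one_tmul]
        exact_mod_cast congrArg (Int.cast : ℤ → ℤ_[p]) (hκB y y)
      -- Modulo `2p`, `Q a` equals `Q l = Q y`, so `a ∈ W` and hence `l ∈ W_p`. Then `f l` lies in
      -- `p M_p`, so `κ y` is divisible by `p` in `M`, which puts `y` in the image of `j`.
      obtain ⟨a, b, rfl⟩ := PadicInt.exists_one_tmul_add_smul l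
      have ha : (2 * p : ℤ_[p]) ∣ (L.Q a : ℤ_[p]) := by
        obtain ⟨k, hk⟩ := hy
        obtain ⟨c, hc⟩ := h.two_dvd_extB ℤ_[p] b
        simp only [map_add, LinearMap.add_apply, map_smul, LinearMap.smul_apply, smul_eq_mul,
          extB_one_tmul, extB_symm ℤ_[p] L b, hc, hk] at hQ
        exact ⟨k - L.extB ℤ_[p] (1 ⊗ₜ a) b - p * c, by rw [Q]; linear_combination hQ⟩
      have haW : a ∈ W := by rwa [hW, ← h.two_mul_dvd_iff]
      obtain ⟨m, hm⟩ : ∃ m, i.baseChange ℤ_[p] m = 1 ⊗ₜ a + (p : ℤ_[p]) • b := by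
        obtain ⟨m, hm⟩ := LinearMap.smul_mem_range_baseChange (R := ℤ_[p]) i hpi b
        let a' : L.sublattice W := ⟨a, haW⟩
        refine ⟨1 ⊗ₜ a' + m, ?_⟩
        rw [map_add, hm, Int.cast_natCast]; rfl
      rw [← hm, hfi] at hl
      obtain ⟨z, hz⟩ := PadicInt.exists_eq_smul_of_one_tmul_eq_smul hl.symm
      exact ⟨z, Subtype.ext hz.symm⟩
    · rintro ⟨x, rfl⟩
      rw [Q, hj, ← extB_one_tmul]
      obtain ⟨m, hm⟩ := e.surjective (1 ⊗ₜ x)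
      rw [← hm, he]
      have hloc : ∀ m : ℤ_[p] ⊗[ℤ] L.sublattice W,
          (2 * p : ℤ_[p]) ∣ (L.sublattice W).extB ℤ_[p] m m := by
        intro m
        obtain ⟨a, b, rfl⟩ := PadicInt.exists_one_tmul_add_smul m
        have ha := (h.two_mul_dvd_iff (p := p) (i a)).2 ((hW _).1 a.2)
        obtain ⟨k, hk⟩ := ha
        rw [Q, hi] at hk
        obtain ⟨c, hc⟩ : (2 : ℤ_[p]) ∣ (L.sublattice W).extB ℤ_[p] b b := by
          have := extB_baseChange ℤ_[p] i (c := 1) (by simpa using hi) b b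
          rw [Int.cast_one, one_mul] at this
          rw [← this]
          exact h.two_dvd_extB _ _
        refine ⟨k + (L.sublattice W).extB ℤ_[p] (1 ⊗ₜ a) b + p * c, ?_⟩
        simp only [map_add, LinearMap.add_apply, map_smul, LinearMap.smul_apply, smul_eq_mul,
          extB_one_tmul, extB_symm ℤ_[p] _ b, hc, hk]
        ring
      exact hloc m

end PosDefLattice
-- Transfer of strict regularity to the Watson transform.
theorem proposition3p4 (p : ℕ) [Fact p.Prime] (n : ℕ) (L : PosDefLattice.{u})
    (hnorm : L.IsNormalized) (hreg : L.IsStrictlyRegular n)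
    (hloc : (p = 2 ∧ L.scale = Ideal.span {2}) ∨
      L.localValues p ≠ (Ideal.span {(2 : ℤ_[p])} : Set ℤ_[p])) :
    (L.watson (2 * p)).IsStrictlyRegular n := by
  have hp0 : (p : ℤ) ≠ 0 := by exact_mod_cast (Fact.out : p.Prime).ne_zero
  have hW : ∀ x, x ∈ L.watsonSubmodule (2 * p) ↔ (2 * p : ℤ) ∣ L.Q x :=
    fun _ => hnorm.mem_watsonSubmodule_iff hloc
  rintro N hN ⟨M, hM, τ, hτ, T, hT⟩
  obtain ⟨K, hK, j, hj, hpj, hQj⟩ := PosDefLattice.InGenus.exists_lift hnorm hW hM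
  have hjinj := PosDefLattice.isometry_injective hj
  let jτ : N →ₗ[ℤ] K := j ∘ₗ τ
  have hjτ : ∀ x y, K.B (jτ x) (jτ y) = N.B x y := fun x y => by
    rw [← hτ, ← hj]; rfl
  -- One division by `p` already yields the saturation of `N` in `K`, because `pK ⊆ j(M)` and `N` is
  -- saturated in `M`.
  let P : Submodule ℤ K := (LinearMap.range jτ).comap ((p : ℤ) • LinearMap.id)
  have hP : ∀ x, x ∈ P ↔ (p : ℤ) • x ∈ LinearMap.range jτ := fun _ => Iff.rfl
  have hjτsat : ∀ k : ℤ, k ≠ 0 → ∀ m, k • j m ∈ LinearMap.range jτ → j m ∈ LinearMap.range jτ := by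
    rintro k hk m ⟨ν, hν⟩
    have : τ ν = k • m := hjinj (by rw [map_smul, ← hν]; rfl)
    obtain ⟨ν', hν'⟩ := hT.mem_of_smul_mem hk (x := m) ⟨ν, this⟩
    exact ⟨ν', by rw [← hν']; rfl⟩
  have hPcompl : ∃ T, IsCompl (LinearMap.range P.subtype) T := by
    rw [Submodule.range_subtype]
    refine P.exists_isCompl_of_saturated fun k hk x hx => ?_
    obtain ⟨m, hm⟩ := hpj x
    rw [hP, ← hm]
    rw [hP, smul_comm, ← hm] at hx
    exact hjτsat k hk m hx
  have hjτP : ∀ ν, jτ ν ∈ P := fun ν => ⟨(p : ℤ) • ν, map_smul _ _ _⟩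
  let g : N →ₗ[ℤ] P := jτ.codRestrict P hjτP
  have hrank : (K.sublattice P).rank = n := by
    rw [← hN]
    apply le_antisymm
    · let m : P →ₗ[ℤ] LinearMap.range jτ :=
        LinearMap.codRestrict _ ((p : ℤ) • P.subtype) fun x => x.2
      have hm : Function.Injective m := fun x y hxy =>
        Subtype.ext (smul_right_injective K hp0 (congrArg Subtype.val hxy))
      exact (LinearMap.finrank_le_finrank_of_injective hm).trans (LinearMap.finrank_range_le jτ)
    · exact LinearMap.finrank_le_finrank_of_injective (f := g) fun x y hxy =>
        PosDefLattice.isometry_injective hjτ (congrArg Subtype.val hxy)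
  obtain ⟨σ, hσ, T', hT'⟩ := hreg (K.sublattice P) hrank
    ⟨K, hK, P.subtype, fun _ _ => rfl, hPcompl⟩
  have hσQ : ∀ x : P, L.Q (σ x) = K.Q x := fun x => hσ x x
  have hσinj := PosDefLattice.isometry_injective hσ
  have hσW : ∀ x : P, σ x ∈ L.watsonSubmodule (2 * p) ↔ (x : K) ∈ LinearMap.range j := fun x => by
    rw [hW, ← hnorm.two_mul_dvd_iff, hσQ, hQj]
  have hmem : ∀ ν, (σ ∘ₗ g) ν ∈ L.watsonSubmodule (2 * p) := fun ν => (hσW _).2 ⟨τ ν, rfl⟩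
  let ρ : N →ₗ[ℤ] L.watson (2 * p) := (σ ∘ₗ g).codRestrict _ hmem
  refine ⟨ρ, fun x y => (hσ _ _).trans (hjτ x y), ?_⟩
  refine Submodule.exists_isCompl_of_saturated _ ?_
  rintro k hk x ⟨ν, hν⟩
  have hν' : σ (g ν) = k • x.1 := congrArg Subtype.val hν
  -- Primitivity of `σ(P)` in `L` gives `x = σ y`; as `x` lies in the Watson transform, `y` comes
  -- from `M`, where `N` is saturated.
  obtain ⟨y, hy⟩ := hT'.mem_of_smul_mem hk (x := x.1) ⟨g ν, hν'⟩
  obtain ⟨m, hm⟩ := (hσW y).1 (hy ▸ x.2)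
  have hky : g ν = k • y := hσinj (by rw [hν', map_smul, hy])
  obtain ⟨ν', hν''⟩ := hjτsat k hk m ⟨ν, by rw [hm]; exact congrArg Subtype.val hky⟩
  refine ⟨ν', Subtype.ext ?_⟩
  have : g ν' = y := Subtype.ext (hν''.trans hm)
  exact (congrArg σ this).trans hy
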